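/- **Setting.** An *$(r,s)$-marked curve of degree* $\Delta=(v(y_1),\dots,v(y_n))$, $v(y_i)\in\mathbb Z^2\setminus\{0\}$, consists of a finite metric graph $\Gamma$, each of whose components has first Betti number $0$, with labeled unbounded edges $x_1,\dots,x_{r+s}$ (the markings; real for $i\le r$, complex for $i>r$) and $y_1,\dots,y_n$ (the ends), and a continuous map $h:\Gamma\to\mathbb R^2$ that is affine linear with integer direction vector on every edge, contracts every $x_i$, has outgoing direction vector $v(y_i)$ on $y_i$, and is balanced: at every vertex the outgoing direction vectors of the adjacent edges sum to $0$. The *weight* $w(e)$ of an edge $e$ is the gcd of the entries of its direction vector; $e$ is *even* or *odd* according to the parity of $w(e)$. The curve is *oriented* if every unmarked edge (every edge other than the $x_i$) carries an orientation; the set $F$ of indices $i$ such that $y_i$ is oriented inwards is the set of *fixed* ends. At a vertex with exactly three adjacent unmarked edges, the Mikhalkin multiplicity $a$ is $|\det|$ of the outgoing direction vectors of any two of them. A connected oriented $(r,s)$-marked curve $C$ is an *old broccoli curve* (a broccoli curve in the sense of [GMS13]) if every vertex $V$ is of one of the following types, where all adjacent markings and unmarked edges are listed: 1. one real marking, two outgoing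 odd edges; $m_V=1$; 2. no marking, three odd edges, two incoming and one outgoing; $m_V=\mathrm i^{a-1}$; 3. no marking, one incoming even edge, one incoming odd edge, one outgoing odd edge; $m_V=a\,\mathrm i^{a-1}$; 4. no marking, three even edges, two incoming and one outgoing; $m_V=a\,\mathrm i^{a-1}$; 5. one complex marking, three outgoing odd edges; $m_V=a\,\mathrm i^{a-1}$; 6. one complex marking, one outgoing even edge and two outgoing odd edges; $m_V=\mathrm i^{a-1}$. Its multiplicity is $m_C=\prod_{k=1}^n \mathrm i^{w(y_k)-1}\prod_V m_V\in\mathbb C$. A connected oriented $(r,s)$-marked curve $C$ is an *oriented refined broccoli curve* if every vertex $V$ is of one of the following types, with edges of any parity: * (I) one real marking, two outgoing unmarked edges; $m_V(y)=1$; * (II) no marking, two incoming and one outgoing unmarked edges; $m_V(y)=\dfrac{y^{a/2}-y^{-a/2}}{y^{1/2}-y^{-1/2}}$; * (III) one complex marking, three outgoing unmarked edges; $m_V(y)=\dfrac{y^{a/2}+y^{-a/2}}{y^{1/2}+y^{-1/2}}$. Put $m_{y_i}(y)=\dfrac{y^{w(y_i)/2}+(-1)^{w(y_i)}y^{-w(y_i)/2}}{y^{1/2}+(-1)^{w(y_i)}y^{-1/2}}$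 for $i\in F$ and $m_{y_i}(y)=\dfrac{y^{w(y_i)/2}-(-1)^{w(y_i)}y^{-w(y_i)/2}}{w(y_i)\,\bigl(y^{1/2}-(-1)^{w(y_i)}y^{-1/2}\bigr)}$ for $i\notin F$. The refined multiplicity of $C$ is $m_C(y)=\prod_{i=1}^n m_{y_i}(y)\prod_V m_V(y)\in\mathbb Q(y^{1/2})$. **Corollary.** Let $C$ be an oriented $(r,s)$-marked curve. (a) If $C$ is an old broccoli curve, then $C$ is an oriented refined broccoli curve; moreover $m_C(y)$ is a Laurent polynomial in $y$ with rational coefficients, and its value at $y=-1$ is $m_C(-1)=m_C$. (b) If $C$ is an oriented refined broccoli curve that is not an old broccoli curve, then $m_C(y)$ is a Laurent polynomial in $y$ with rational coefficients, and $m_C(-1)=0$. -/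

import Mathlib

/-! ### Plane tropical rational marked curves -/

/-- The determinant of two vectors of `ℤ²`. -/
def det2 (u v : ℤ × ℤ) : ℤ := u.1 * v.2 - u.2 * v.1

/-- The weight of an edge with direction vector `v`: the gcd of the entries of `v`. -/
def vecWeight (v : ℤ × ℤ) : ℕ := Int.gcd v.1 v.2

/-- The abstract graph of a (not necessarily connected) rational curve with `r` real markings,
`s` complex markings and `n` labeled unmarked ends, with finite vertex set `V`: the bounded edges
form the graph `bdd`, each component of which has first Betti number zero (this excludes loops and
multiple edges, so a simple graph records all of it), `len` is the length of the bounded edges, and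
every unbounded edge (real marking, complex marking, unmarked end) is given by the vertex that it
is attached to. -/
structure MarkedGraph (V : Type*) (r s n : ℕ) where
  bdd : SimpleGraph V
  rational : bdd.IsAcyclic
  len : bdd.edgeSet → ℝ
  len_pos : ∀ e, 0 < len e
  realMark : Fin r → V
  cplxMark : Fin s → V
  endAt : Fin n → V

namespace MarkedGraph

variable {V : Type*} {r s n : ℕ}

/-- The unmarked edges adjacent to the vertex `v`: the bounded edges, each given as the
oriented edge (dart) that starts at `v`, and the unmarked ends. -/
def Flag (Γ : MarkedGraph V r s n) (v : V) : Type _ :=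
  {d : Γ.bdd.Dart // d.fst = v} ⊕ {i : Fin n // Γ.endAt i = v}

instance (Γ : MarkedGraph V r s n) [Finite V] (v : V) : Finite (Γ.Flag v) := by
  classical
  have := Fintype.ofFinite V
  unfold Flag
  infer_instance

noncomputable instance (Γ : MarkedGraph V r s n) [Finite V] (v : V) : Fintype (Γ.Flag v) :=
  Fintype.ofFinite _

end MarkedGraph

/-- An `(r,s)`-marked plane tropical rational parametrized curve of degree `Δ`. The map
`h : Γ → ℝ²` is given by the positions `pos` of the vertices and the integer direction vectors of
the edges: `dir d` is the slope of `h` along the bounded edge `d`, traversed from `d.fst` to `d.snd`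
(so `h` is `pos d.fst + t • dir d` at distance `t` from `d.fst`), the slope of the unmarked end
`i`, pointing to infinity, is the nonzero vector `Δ i`, and `h` contracts every marking. -/
structure MarkedCurve (V : Type*) [Finite V] (r s : ℕ) {n : ℕ} (Δ : Fin n → ℤ × ℤ)
    extends MarkedGraph V r s n where
  pos : V → ℝ × ℝ
  dir : bdd.Dart → ℤ × ℤ
  dir_symm : ∀ d, dir d.symm = - dir d
  affine : ∀ d : bdd.Dart, pos d.snd =
    pos d.fst + len ⟨d.edge, d.edge_mem⟩ • (((dir d).1 : ℝ), ((dir d).2 : ℝ))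
  degree_ne_zero : ∀ i, Δ i ≠ 0
  balanced : ∀ v : V, ∑ e : toMarkedGraph.Flag v,
    Sum.elim (fun d => dir d.1) (fun i => Δ i.1) e = 0

/-- An oriented `(r,s)`-marked curve: every unmarked edge carries an orientation. For a bounded edge,
`orient d` says that the dart `d` points in the direction of the orientation. `F` is the set of
fixed ends, i.e. of the unmarked ends that are oriented inwards; the others are oriented
outwards. -/
structure OrientedMarkedCurve (V : Type*) [Finite V] (r s : ℕ) {n : ℕ} (Δ : Fin n → ℤ × ℤ)
    extends MarkedCurve V r s Δ where
  orient : bdd.Dart → Prop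
  orient_symm : ∀ d, orient d.symm ↔ ¬ orient d
  F : Finset (Fin n)

/-- The local data at a vertex from which its type is read off: the numbers of adjacent real and
complex markings, and the numbers of adjacent unmarked edges that are odd/even and oriented
towards the vertex (`In`) or away from it (`Out`). -/
structure VertexData where
  realMarks : ℕ
  cplxMarks : ℕ
  oddIn : ℕ
  oddOut : ℕ
  evenIn : ℕ
  evenOut : ℕ

/-- The vertex types (1), ..., (6) of broccoli curves. -/
inductive OldVertexType
  | one | two | three | four | five | six

/-- * (1): a real marking and two outgoing odd edges;
* (2): no marking, three odd edges, two of them incoming, one outgoing;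
* (3): no marking, an incoming even edge, an incoming odd edge, an outgoing odd edge;
* (4): no marking, three even edges, two of them incoming, one outgoing;
* (5): a complex marking and three outgoing odd edges;
* (6): a complex marking, an outgoing even edge and two outgoing odd edges, parallel (6b) or
  not (6a). -/
def OldVertexType.data : OldVertexType → VertexData
  | .one   => { realMarks := 1, cplxMarks := 0, oddIn := 0, oddOut := 2, evenIn := 0, evenOut := 0 }
  | .two   => { realMarks := 0, cplxMarks := 0, oddIn := 2, oddOut := 1, evenIn := 0, evenOut := 0 }
  | .three => { realMarks := 0, cplxMarks := 0, oddIn := 1, oddOut := 1, evenIn := 1, evenOut := 0 }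
  | .four  => { realMarks := 0, cplxMarks := 0, oddIn := 0, oddOut := 0, evenIn := 2, evenOut := 1 }
  | .five  => { realMarks := 0, cplxMarks := 1, oddIn := 0, oddOut := 3, evenIn := 0, evenOut := 0 }
  | .six   => { realMarks := 0, cplxMarks := 1, oddIn := 0, oddOut := 2, evenIn := 0, evenOut := 1 }

/-- The multiplicity of a vertex of the given type and of Mikhalkin multiplicity `a`. -/
noncomputable def OldVertexType.mult (a : ℕ) : OldVertexType → ℂ
  | .one   => 1
  | .two   => Complex.I ^ ((a : ℤ) - 1)
  | .three => a * Complex.I ^ ((a : ℤ) - 1)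
  | .four  => a * Complex.I ^ ((a : ℤ) - 1)
  | .five  => a * Complex.I ^ ((a : ℤ) - 1)
  | .six   => Complex.I ^ ((a : ℤ) - 1)

/-- The variable `y^{1/2}` of the field `ℚ(y^{1/2})`. -/
noncomputable abbrev yHalf : RatFunc ℚ := RatFunc.X

namespace VertexData

/-- Type (I): a real marking and two outgoing unmarked edges, of any parity. -/
def IsTypeI (D : VertexData) : Prop :=
  D.realMarks = 1 ∧ D.cplxMarks = 0 ∧ D.oddIn + D.evenIn = 0 ∧ D.oddOut + D.evenOut = 2

/-- Type (II): no marking, two incoming and one outgoing unmarked edges, of any parity. -/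
def IsTypeII (D : VertexData) : Prop :=
  D.realMarks = 0 ∧ D.cplxMarks = 0 ∧ D.oddIn + D.evenIn = 2 ∧ D.oddOut + D.evenOut = 1

/-- Type (III): a complex marking and three outgoing unmarked edges, of any parity. -/
def IsTypeIII (D : VertexData) : Prop :=
  D.realMarks = 0 ∧ D.cplxMarks = 1 ∧ D.oddIn + D.evenIn = 0 ∧ D.oddOut + D.evenOut = 3

open Classical in
/-- The old multiplicity of a vertex with data `D` and Mikhalkin multiplicity `a`, meant for
vertices of types (1), ..., (6) (`0` for all others); the type is determined by `D`. -/
noncomputable def oldMult (D : VertexData) (a : ℕ) : ℂ :=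
  if h : ∃ τ : OldVertexType, D = τ.data then h.choose.mult a else 0

open Classical in
/-- The refined multiplicity of a vertex with data `D` and Mikhalkin multiplicity `a`, as an element
of the field `ℚ(y^{1/2})`, meant for vertices of types (I), (II), (III) (`0` for all others). -/
noncomputable def refinedMult (D : VertexData) (a : ℕ) : RatFunc ℚ :=
  if D.IsTypeI then 1
  else if D.IsTypeII then
    (yHalf ^ a - yHalf ^ (-(a : ℤ))) / (yHalf - yHalf ^ (-1 : ℤ))
  else if D.IsTypeIII then
    (yHalf ^ a + yHalf ^ (-(a : ℤ))) / (yHalf + yHalf ^ (-1 : ℤ))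
  else 0

end VertexData

/-- The refined multiplicity in `ℚ(y^{1/2})` of a fixed end of weight `w`. -/
noncomputable def fixedEndMult (w : ℕ) : RatFunc ℚ :=
  (yHalf ^ w + (-1) ^ w * yHalf ^ (-(w : ℤ))) /
    (yHalf + (-1) ^ w * yHalf ^ (-1 : ℤ))

/-- The refined multiplicity in `ℚ(y^{1/2})` of a non-fixed end of weight `w`. -/
noncomputable def freeEndMult (w : ℕ) : RatFunc ℚ :=
  (yHalf ^ w - (-1) ^ w * yHalf ^ (-(w : ℤ))) /
    (w * (yHalf - (-1) ^ w * yHalf ^ (-1 : ℤ)))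

namespace OrientedMarkedCurve

variable {V : Type*} [Finite V] {r s n : ℕ} {Δ : Fin n → ℤ × ℤ}

/-- The direction vector, pointing away from `v`, of an unmarked edge adjacent to `v`. -/
def vec (C : OrientedMarkedCurve V r s Δ) {v : V} (e : C.Flag v) : ℤ × ℤ :=
  Sum.elim (fun d => C.dir d.1) (fun i => Δ i.1) e

/-- The unmarked edge `e` adjacent to `v` is oriented away from `v`. -/
def IsOut (C : OrientedMarkedCurve V r s Δ) {v : V} (e : C.Flag v) : Prop :=
  Sum.elim (fun d => C.orient d.1) (fun i => i.1 ∉ C.F) e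

/-- An edge is even if its weight is even, otherwise odd. -/
def IsEvenEdge (C : OrientedMarkedCurve V r s Δ) {v : V} (e : C.Flag v) : Prop :=
  Even (vecWeight (C.vec e))

/-- The data from which the type of the vertex `v` is read off. -/
noncomputable def vertexData (C : OrientedMarkedCurve V r s Δ) (v : V) : VertexData where
  realMarks := Nat.card {k : Fin r // C.realMark k = v}
  cplxMarks := Nat.card {k : Fin s // C.cplxMark k = v}
  oddIn := Nat.card {e : C.Flag v // ¬ C.IsEvenEdge e ∧ ¬ C.IsOut e}
  oddOut := Nat.card {e : C.Flag v // ¬ C.IsEvenEdge e ∧ C.IsOut e}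
  evenIn := Nat.card {e : C.Flag v // C.IsEvenEdge e ∧ ¬ C.IsOut e}
  evenOut := Nat.card {e : C.Flag v // C.IsEvenEdge e ∧ C.IsOut e}

/-- The Mikhalkin multiplicity of a vertex with three adjacent unmarked edges: the absolute
value of the determinant of the direction vectors of two of these edges. By the balancing
condition it does not depend on the choice of the two edges, so it is the maximum over all pairs
of adjacent edges (see `mikhalkinMult_eq`). -/
noncomputable def mikhalkinMult (C : OrientedMarkedCurve V r s Δ) (v : V) : ℕ :=
  Finset.univ.sup fun e : C.Flag v × C.Flag v => (det2 (C.vec e.1) (C.vec e.2)).natAbs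

theorem mikhalkinMult_eq (C : OrientedMarkedCurve V r s Δ) (v : V)
    (h : Nat.card (C.Flag v) = 3) {e e' : C.Flag v} (hne : e ≠ e') :
    C.mikhalkinMult v = (det2 (C.vec e) (C.vec e')).natAbs := by
  classical
  have hc : Fintype.card (C.Flag v) = 3 := by rw [← Nat.card_eq_fintype_card]; exact h
  obtain ⟨f, hf⟩ : ∃ f, f ∉ ({e, e'} : Finset (C.Flag v)) := by
    by_contra! hall
    have h1 := Finset.card_le_card (fun x _ => hall x : (Finset.univ : Finset (C.Flag v)) ⊆ _)
    have h2 := Finset.card_le_two (a := e) (b := e')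
    rw [Finset.card_univ, hc] at h1
    omega
  simp only [Finset.mem_insert, Finset.mem_singleton, not_or] at hf
  have hu : (Finset.univ : Finset (C.Flag v)) = {e, e', f} := by
    symm
    apply Finset.eq_univ_of_card
    rw [hc, Finset.card_eq_three]
    exact ⟨e, e', f, hne, fun h => hf.1 h.symm, fun h => hf.2 h.symm, rfl⟩
  have hb : ∑ x : C.Flag v, C.vec x = 0 := C.balanced v
  rw [hu, Finset.sum_insert (by simp [hne, Ne.symm hf.1]),
    Finset.sum_insert (by simp [Ne.symm hf.2]), Finset.sum_singleton] at hb
  have h1 := congrArg Prod.fst hb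
  have h2 := congrArg Prod.snd hb
  simp only [Prod.fst_add, Prod.snd_add, Prod.fst_zero, Prod.snd_zero] at h1 h2
  have f1 : (C.vec f).1 = - (C.vec e).1 - (C.vec e').1 := by linarith
  have f2 : (C.vec f).2 = - (C.vec e).2 - (C.vec e').2 := by linarith
  apply le_antisymm
  · apply Finset.sup_le
    rintro ⟨x, z⟩ -
    have hx : x ∈ ({e, e', f} : Finset (C.Flag v)) := hu ▸ Finset.mem_univ x
    have hz : z ∈ ({e, e', f} : Finset (C.Flag v)) := hu ▸ Finset.mem_univ z
    simp only [Finset.mem_insert, Finset.mem_singleton] at hx hz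
    have key : det2 (C.vec x) (C.vec z) = 0 ∨
        det2 (C.vec x) (C.vec z) = det2 (C.vec e) (C.vec e') ∨
        det2 (C.vec x) (C.vec z) = - det2 (C.vec e) (C.vec e') := by
      unfold det2
      rcases hx with h | h | h <;> rcases hz with h' | h' | h' <;> rw [h, h'] <;>
        try rw [f1, f2]
      · left; ring
      · right; left; rfl
      · right; right; ring
      · right; right; ring
      · left; ring
      · right; left; ring
      · right; left; ring
      · right; right; ring
      · left; ring
    show (det2 (C.vec x) (C.vec z)).natAbs ≤ _
    rcases key with h | h | h <;> simp [h]
  · exact Finset.le_sup (f := fun p : C.Flag v × C.Flag v =>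
      (det2 (C.vec p.1) (C.vec p.2)).natAbs) (Finset.mem_univ (e, e'))

/-- The curve is connected. -/
def Connected (C : OrientedMarkedCurve V r s Δ) : Prop := C.bdd.Connected

/-- Broccoli curves in the old sense: connected oriented marked curves all of whose vertices
are of the types (1), ..., (6). -/
def IsOldBroccoli (C : OrientedMarkedCurve V r s Δ) : Prop :=
  C.Connected ∧ ∀ v, ∃ τ : OldVertexType, C.vertexData v = τ.data

/-- Oriented refined broccoli curves: connected oriented marked curves all of whose vertices
are of the types (I), (II), (III). -/
def IsRefinedBroccoli (C : OrientedMarkedCurve V r s Δ) : Prop :=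
  C.Connected ∧
    ∀ v, (C.vertexData v).IsTypeI ∨ (C.vertexData v).IsTypeII ∨ (C.vertexData v).IsTypeIII

end OrientedMarkedCurve

namespace OrientedMarkedCurve

variable {V : Type*} [Fintype V] {r s n : ℕ} {Δ : Fin n → ℤ × ℤ}

/-- The multiplicity `m_C = ∏ i^{w(y_k)-1} ∏ m_V` of a connected old broccoli curve. -/
noncomputable def oldMult (C : OrientedMarkedCurve V r s Δ) : ℂ :=
  (∏ k : Fin n, Complex.I ^ ((vecWeight (Δ k) : ℤ) - 1)) *
    ∏ v : V, (C.vertexData v).oldMult (C.mikhalkinMult v)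

/-- The refined multiplicity `m_C(y)` of an oriented refined broccoli curve, as an element
of `ℚ(y^{1/2})`. -/
noncomputable def refinedMult (C : OrientedMarkedCurve V r s Δ) : RatFunc ℚ :=
  (∏ i : Fin n, if i ∈ C.F then fixedEndMult (vecWeight (Δ i)) else freeEndMult (vecWeight (Δ i))) *
    ∏ v : V, (C.vertexData v).refinedMult (C.mikhalkinMult v)

end OrientedMarkedCurve

/-- The embedding `ℚ[y, y⁻¹] → ℚ(y^{1/2})`; it sends `y` to `(y^{1/2})²`. -/
noncomputable def laurentToRatFunc : LaurentPolynomial ℚ →+* RatFunc ℚ :=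
  LaurentPolynomial.eval₂ (algebraMap ℚ (RatFunc ℚ)) (Units.mk0 yHalf RatFunc.X_ne_zero ^ 2)

/-- `f ∈ ℚ(y^{1/2})` is a Laurent polynomial in `y`, and the value of this Laurent
polynomial at `y = y₀` is `c`. -/
def SpecializesTo (f : RatFunc ℚ) (y₀ : ℂˣ) (c : ℂ) : Prop :=
  ∃ P : LaurentPolynomial ℚ, laurentToRatFunc P = f ∧
    LaurentPolynomial.eval₂ (algebraMap ℚ ℂ) y₀ P = c

/-! ### Specialization at `y = -1` -/

/-! Put θ = y^{1/2} + y^{-1/2} (`yTheta`). It is not a Laurent polynomial in y, but θ² = y + 2 +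
y^{-1} is, and it vanishes at y = -1. Every factor of m_C(y) is θ^e times a Laurent polynomial in y
with e ∈ {-1, 0, 1}. `HasOrder` records e and a leading coefficient c. Its normalization is natural:
for y^{1/2} = i·exp(u) one has θ/(2i) = sinh u, so c is the coefficient of u^e.

A fixed even end has e = -1, a free even end e = 1, an odd end e = 0 (`hasOrder_fixedEndMult`,
`hasOrder_freeEndMult`). At a vertex, balancing modulo 2 restricts the parities
(`parityCompatible`), and a case check gives e = (incoming even edges) - (outgoing even edges), plus
2 if the vertex is not of an old type (`order_eq`).

Summed over the curve, each bounded even edge cancels and each even end cancels its own exponent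
(`sum_evenIn_sub_evenOut`). Hence the total exponent is twice the number of vertices of non-old
type. If there are none, the value is the product of the leading coefficients, which are the old
multiplicities. Otherwise a positive power of θ² splits off and the value is 0. -/

theorem SpecializesTo.mul {f g : RatFunc ℚ} {z : ℂˣ} {c d : ℂ} (hf : SpecializesTo f z c)
    (hg : SpecializesTo g z d) : SpecializesTo (f * g) z (c * d) := by
  obtain ⟨P, rfl, rfl⟩ := hf
  obtain ⟨Q, rfl, rfl⟩ := hg
  exact ⟨P * Q, map_mul _ _ _, map_mul _ _ _⟩

theorem SpecializesTo.add {f g : RatFunc ℚ} {z : ℂˣ} {c d : ℂ} (hf : SpecializesTo f z c)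
    (hg : SpecializesTo g z d) : SpecializesTo (f + g) z (c + d) := by
  obtain ⟨P, rfl, rfl⟩ := hf
  obtain ⟨Q, rfl, rfl⟩ := hg
  exact ⟨P + Q, map_add _ _ _, map_add _ _ _⟩

theorem SpecializesTo.neg {f : RatFunc ℚ} {z : ℂˣ} {c : ℂ} (hf : SpecializesTo f z c) :
    SpecializesTo (-f) z (-c) := by
  obtain ⟨P, rfl, rfl⟩ := hf
  exact ⟨-P, map_neg _ _, map_neg _ _⟩

theorem specializesTo_one (z : ℂˣ) : SpecializesTo 1 z 1 := ⟨1, map_one _, map_one _⟩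

theorem specializesTo_zero (z : ℂˣ) : SpecializesTo 0 z 0 := ⟨0, map_zero _, map_zero _⟩

theorem SpecializesTo.pow {f : RatFunc ℚ} {z : ℂˣ} {c : ℂ} (hf : SpecializesTo f z c) (k : ℕ) :
    SpecializesTo (f ^ k) z (c ^ k) := by
  obtain ⟨P, rfl, rfl⟩ := hf
  exact ⟨P ^ k, map_pow _ _ _, map_pow _ _ _⟩

theorem SpecializesTo.prod {ι : Type*} (t : Finset ι) {f : ι → RatFunc ℚ} {z : ℂˣ} {c : ι → ℂ}
    (h : ∀ i ∈ t, SpecializesTo (f i) z (c i)) :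
    SpecializesTo (∏ i ∈ t, f i) z (∏ i ∈ t, c i) := by
  classical
  induction t using Finset.induction_on with
  | empty => simpa using specializesTo_one z
  | insert i t hi ih =>
    rw [Finset.prod_insert hi, Finset.prod_insert hi]
    exact (h i (Finset.mem_insert_self i t)).mul
      (ih fun j hj => h j (Finset.mem_insert_of_mem hj))

theorem specializesTo_natCast_inv (k : ℕ) (z : ℂˣ) :
    SpecializesTo ((k : RatFunc ℚ)⁻¹) z ((k : ℂ)⁻¹) := by
  refine ⟨LaurentPolynomial.C ((k : ℚ)⁻¹), ?_, ?_⟩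
  · rw [laurentToRatFunc, LaurentPolynomial.eval₂_C]; simp
  · rw [LaurentPolynomial.eval₂_C]; simp

theorem specializesTo_T (k : ℤ) : SpecializesTo (yHalf ^ (2 * k)) (-1) ((-1) ^ k) := by
  refine ⟨LaurentPolynomial.T k, ?_, ?_⟩
  · rw [laurentToRatFunc, LaurentPolynomial.eval₂_T]
    simp [zpow_mul]
  · rw [LaurentPolynomial.eval₂_T]
    simp

theorem specializesTo_yHalf_pow (k : ℕ) :
    SpecializesTo (yHalf ^ (2 * k)) (-1) ((-1) ^ k) := by
  exact_mod_cast specializesTo_T k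

theorem specializesTo_yHalf_pow_inv (k : ℕ) :
    SpecializesTo (yHalf ^ (2 * k))⁻¹ (-1) ((-1) ^ k) := by
  have h := specializesTo_T (-k)
  rw [mul_neg, zpow_neg, zpow_neg, zpow_natCast, ← inv_pow, inv_neg, inv_one] at h
  exact_mod_cast h

/-! ### Nonvanishing denominators and the element θ. -/

theorem yHalf_ne_zero : yHalf ≠ 0 := RatFunc.X_ne_zero

theorem yHalf_sq_ne (c : ℚ) : yHalf ^ 2 ≠ RatFunc.C c := by
  intro h
  have h1 : algebraMap (Polynomial ℚ) (RatFunc ℚ) (Polynomial.X ^ 2) =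
      algebraMap (Polynomial ℚ) (RatFunc ℚ) (Polynomial.C c) := by
    simpa [RatFunc.algebraMap_X, RatFunc.algebraMap_C] using h
  have h2 := congrArg Polynomial.natDegree (RatFunc.algebraMap_injective ℚ h1)
  simp at h2

/-- The rational function `y^{1/2} + y^{-1/2}`, which has a simple zero at `y^{1/2} = i`. -/
noncomputable def yTheta : RatFunc ℚ := yHalf + yHalf ^ (-1 : ℤ)

theorem yTheta_ne_zero : yTheta ≠ 0 := by
  intro h
  apply yHalf_sq_ne (-1)
  have h0 := yHalf_ne_zero
  rw [yTheta, zpow_neg_one] at h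
  field_simp at h
  rw [map_neg, map_one]
  linear_combination h

theorem yHalf_sub_inv_ne_zero : yHalf - yHalf ^ (-1 : ℤ) ≠ 0 := by
  intro h
  apply yHalf_sq_ne 1
  have h0 := yHalf_ne_zero
  rw [zpow_neg_one] at h
  field_simp at h
  rw [map_one]
  linear_combination h

theorem specializesTo_yTheta_sq : SpecializesTo (yTheta ^ 2) (-1) 0 := by
  have h := ((specializesTo_yHalf_pow 1).add (specializesTo_yHalf_pow_inv 1)).add
    ((specializesTo_one (-1)).add (specializesTo_one (-1)))
  convert h using 1
  · have h0 := yHalf_ne_zero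
    rw [yTheta, zpow_neg_one]
    field_simp
    ring
  · norm_num

/-! ### Values at y = -1 of the four basic quotients. -/

theorem I_zpow_two_mul (b : ℕ) : Complex.I ^ (((2 * b + 1 : ℕ) : ℤ) - 1) = (-1) ^ b := by
  push_cast
  rw [add_sub_cancel_right, zpow_mul]
  norm_cast
  simp

theorem I_zpow_two_mul_sub_one (b : ℕ) :
    Complex.I ^ (((2 * b : ℕ) : ℤ) - 1) * Complex.I = (-1) ^ b := by
  rw [zpow_sub_one₀ Complex.I_ne_zero, inv_mul_cancel_right₀ Complex.I_ne_zero]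
  norm_cast
  simp [pow_mul]

/-- For a = 2b + 1 the quotient is y^b + y^{b-1} + ... + y^{-b}; the induction adds the two
outermost terms. -/
theorem specializesTo_sub_of_odd {a : ℕ} (ha : Odd a) :
    SpecializesTo ((yHalf ^ a - yHalf ^ (-(a : ℤ))) / (yHalf - yHalf ^ (-1 : ℤ))) (-1)
      (Complex.I ^ ((a : ℤ) - 1)) := by
  obtain ⟨b, rfl⟩ := ha
  rw [I_zpow_two_mul]
  have h0 := yHalf_ne_zero
  have h1 := yHalf_sub_inv_ne_zero
  induction b with
  | zero =>
    have h := specializesTo_one (-1)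
    rw [← div_self h1] at h
    simpa using h
  | succ b ih =>
    have h := ih.add ((specializesTo_yHalf_pow (b + 1)).add (specializesTo_yHalf_pow_inv (b + 1)))
    convert h using 1
    · rw [div_add' _ _ _ h1]
      congr 1
      rw [zpow_neg, zpow_neg, zpow_neg_one, zpow_natCast, zpow_natCast]
      field_simp
      ring
    · ring

/-- The quotient is now the alternating sum y^b - y^{b-1} + ... + y^{-b}. At y = -1 all a terms
agree, which produces the factor a. -/
theorem specializesTo_add_of_odd {a : ℕ} (ha : Odd a) :
    SpecializesTo ((yHalf ^ a + yHalf ^ (-(a : ℤ))) / (yHalf + yHalf ^ (-1 : ℤ))) (-1)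
      (a * Complex.I ^ ((a : ℤ) - 1)) := by
  obtain ⟨b, rfl⟩ := ha
  rw [I_zpow_two_mul]
  have h0 := yHalf_ne_zero
  have h1 : yHalf + yHalf ^ (-1 : ℤ) ≠ 0 := yTheta_ne_zero
  induction b with
  | zero =>
    have h := specializesTo_one (-1)
    rw [← div_self h1] at h
    simpa using h
  | succ b ih =>
    have h := ih.neg.add ((specializesTo_yHalf_pow (b + 1)).add (specializesTo_yHalf_pow_inv (b + 1)))
    convert h using 1
    · rw [← neg_div, div_add' _ _ _ h1]
      congr 1
      rw [zpow_neg, zpow_neg, zpow_neg_one, zpow_natCast, zpow_natCast]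
      field_simp
      ring
    · push_cast
      ring

/-- For a = 2b the denominator becomes y - y^{-1}, and the quotient is y^{b-1} + y^{b-3} + ... +
y^{1-b}: b terms, all equal at y = -1. -/
theorem specializesTo_sub_of_even {a : ℕ} (ha : Even a) :
    SpecializesTo ((yHalf ^ a - yHalf ^ (-(a : ℤ))) / (yHalf - yHalf ^ (-1 : ℤ)) / yTheta) (-1)
      (a * Complex.I ^ ((a : ℤ) - 1) / (2 * Complex.I)) := by
  obtain ⟨b, rfl⟩ := ha
  rw [← two_mul]
  have e : ((2 * b : ℕ) : ℂ) * Complex.I ^ (((2 * b : ℕ) : ℤ) - 1) / (2 * Complex.I) =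
      - (b * (-1) ^ b) := by
    rw [← I_zpow_two_mul_sub_one]
    have := Complex.I_sq
    have := Complex.I_ne_zero
    field_simp
    push_cast
    rw [Complex.I_sq]
    ring
  rw [e]
  have h0 := yHalf_ne_zero
  have h1 := yHalf_sub_inv_ne_zero
  have h2 := yTheta_ne_zero
  clear e
  induction b with
  | zero => simpa using specializesTo_zero (-1)
  | succ b ih =>
    -- Recursion q_{b+1} = y·q_b + y^{-b} for these sums.
    have h := ((specializesTo_yHalf_pow 1).mul ih).add (specializesTo_yHalf_pow_inv b)
    convert h using 1
    · rw [div_div, div_div, mul_div_assoc', div_add' _ _ _ (mul_ne_zero h1 h2)]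
      congr 1
      rw [yTheta, zpow_neg, zpow_neg, zpow_neg_one, zpow_natCast, zpow_natCast]
      field_simp
      ring
    · push_cast
      ring

theorem specializesTo_add_of_even {a : ℕ} (ha : Even a) :
    SpecializesTo ((yHalf ^ a + yHalf ^ (-(a : ℤ))) / (yHalf + yHalf ^ (-1 : ℤ)) * yTheta) (-1)
      (Complex.I ^ ((a : ℤ) - 1) * (2 * Complex.I)) := by
  obtain ⟨b, rfl⟩ := ha
  rw [← two_mul]
  have h := (specializesTo_yHalf_pow b).add (specializesTo_yHalf_pow_inv b)
  convert h using 1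
  · rw [← yTheta, div_mul_cancel₀ _ yTheta_ne_zero, zpow_neg, zpow_natCast]
  · rw [mul_left_comm, I_zpow_two_mul_sub_one]
    ring

/-! ### Orders along θ and the factors of the ends. -/

/-- `f / (y^{1/2} + y^{-1/2})^e` is a Laurent polynomial in `y` with value `c / (2i)^e`
at `y = -1`. -/
def HasOrder (f : RatFunc ℚ) (e : ℤ) (c : ℂ) : Prop :=
  SpecializesTo (f * yTheta ^ (-e)) (-1) (c * (2 * Complex.I) ^ (-e))

theorem two_mul_I_ne_zero : 2 * Complex.I ≠ 0 := mul_ne_zero two_ne_zero Complex.I_ne_zero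

theorem HasOrder.mul {f g : RatFunc ℚ} {d e : ℤ} {b c : ℂ} (hf : HasOrder f d b)
    (hg : HasOrder g e c) : HasOrder (f * g) (d + e) (b * c) := by
  have h := SpecializesTo.mul hf hg
  rw [HasOrder, neg_add, zpow_add₀ yTheta_ne_zero, zpow_add₀ two_mul_I_ne_zero]
  convert h using 1 <;> ring

theorem HasOrder.prod {ι : Type*} (t : Finset ι) {f : ι → RatFunc ℚ} {e : ι → ℤ} {c : ι → ℂ}
    (h : ∀ i ∈ t, HasOrder (f i) (e i) (c i)) :
    HasOrder (∏ i ∈ t, f i) (∑ i ∈ t, e i) (∏ i ∈ t, c i) := by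
  classical
  induction t using Finset.induction_on with
  | empty => simpa [HasOrder] using specializesTo_one (-1)
  | insert i t hi ih =>
    rw [Finset.prod_insert hi, Finset.prod_insert hi, Finset.sum_insert hi]
    exact (h i (Finset.mem_insert_self i t)).mul
      (ih fun j hj => h j (Finset.mem_insert_of_mem hj))

theorem hasOrder_zero {f : RatFunc ℚ} {c : ℂ} : HasOrder f 0 c ↔ SpecializesTo f (-1) c := by
  simp [HasOrder]

theorem hasOrder_one {f : RatFunc ℚ} {c : ℂ} :
    HasOrder f 1 c ↔ SpecializesTo (f / yTheta) (-1) (c / (2 * Complex.I)) := by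
  rw [HasOrder, zpow_neg_one, zpow_neg_one, div_eq_mul_inv, div_eq_mul_inv]

theorem hasOrder_neg_one {f : RatFunc ℚ} {c : ℂ} :
    HasOrder f (-1) c ↔ SpecializesTo (f * yTheta) (-1) (c * (2 * Complex.I)) := by
  rw [HasOrder, neg_neg, zpow_one, zpow_one]

theorem HasOrder.specializesTo_zero {f : RatFunc ℚ} {k : ℕ} {c : ℂ} (hk : k ≠ 0)
    (h : HasOrder f (2 * k) c) : SpecializesTo f (-1) 0 := by
  -- Multiplying back by (θ²)^k stays within Laurent polynomials in y and gives the value 0, as k ≠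
  -- 0.
  have h' := SpecializesTo.mul h (specializesTo_yTheta_sq.pow k)
  convert h' using 1
  · have : (yTheta ^ 2) ^ k = yTheta ^ (2 * k : ℤ) := by
      rw [← pow_mul]
      norm_cast
    rw [this, mul_assoc, ← zpow_add₀ yTheta_ne_zero]
    simp
  · simp [hk]

/-- The sign (-1)^w selects the plus quotient, with a pole along θ, for even w and the minus
quotient for odd w. -/
theorem hasOrder_fixedEndMult (w : ℕ) :
    HasOrder (fixedEndMult w) (if Even w then -1 else 0) (Complex.I ^ ((w : ℤ) - 1)) := by
  split_ifs with h
  · rw [hasOrder_neg_one, fixedEndMult, h.neg_one_pow, one_mul, one_mul]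
    exact specializesTo_add_of_even h
  · rw [Nat.not_even_iff_odd] at h
    rw [hasOrder_zero, fixedEndMult, h.neg_one_pow, neg_one_mul, neg_one_mul, ← sub_eq_add_neg,
      ← sub_eq_add_neg]
    exact specializesTo_sub_of_odd h

/-- The signs are opposite to those of a fixed end; both resulting quotients carry a factor w at y =
-1, which the 1/w in the definition removes. -/
theorem hasOrder_freeEndMult {w : ℕ} (hw : w ≠ 0) :
    HasOrder (freeEndMult w) (if Even w then 1 else 0) (Complex.I ^ ((w : ℤ) - 1)) := by
  have hw' : (w : ℂ) ≠ 0 := Nat.cast_ne_zero.2 hw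
  split_ifs with h
  · rw [hasOrder_one, freeEndMult, h.neg_one_pow, one_mul, one_mul]
    have h' := (specializesTo_natCast_inv w (-1)).mul (specializesTo_sub_of_even h)
    convert h' using 1
    · rw [← div_div]; ring
    · field_simp
  · rw [Nat.not_even_iff_odd] at h
    rw [hasOrder_zero, freeEndMult, h.neg_one_pow, neg_one_mul, neg_one_mul, sub_neg_eq_add,
      sub_neg_eq_add]
    have h' := (specializesTo_natCast_inv w (-1)).mul (specializesTo_add_of_odd h)
    convert h' using 1
    · rw [← div_div]; ring
    · field_simp

/-! ### Parity at the vertices -/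

theorem even_vecWeight_iff (v : ℤ × ℤ) : Even (vecWeight v) ↔ Even v.1 ∧ Even v.2 := by
  rw [even_iff_two_dvd, even_iff_two_dvd, even_iff_two_dvd, vecWeight, ← Int.natCast_dvd_natCast]
  exact Int.dvd_coe_gcd_iff

theorem vecWeight_ne_zero {v : ℤ × ℤ} (hv : v ≠ 0) : vecWeight v ≠ 0 := by
  intro h
  rw [vecWeight, Int.gcd_eq_zero_iff] at h
  exact hv (Prod.ext h.1 h.2)

/-! ### Vertex types: order and leading coefficient. -/

namespace VertexData

/-- The order of the multiplicity of a vertex with data `D` at `y^{1/2} = i`, for the types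
(I), (II), (III). -/
def order (D : VertexData) : ℤ :=
  if D.cplxMarks = 1 then if D.evenIn + D.evenOut = 0 then 0 else -1
  else if D.realMarks = 1 then 0
  else if D.evenIn + D.evenOut = 0 then 0 else 1

/-- The data are compatible with the balancing condition and Mikhalkin multiplicity `a`. -/
def ParityCompatible (D : VertexData) (a : ℕ) : Prop :=
  (D.oddIn + D.oddOut + D.evenIn + D.evenOut = 2 →
    D.evenIn + D.evenOut = 0 ∨ D.evenIn + D.evenOut = 2) ∧
  (D.oddIn + D.oddOut + D.evenIn + D.evenOut = 3 →
    D.evenIn + D.evenOut = 0 ∧ Odd a ∨ D.evenIn + D.evenOut = 1 ∧ Even a ∨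
      D.evenIn + D.evenOut = 3 ∧ Even a)

/-- The six data are pairwise distinct, so the chosen type can only be τ. -/
theorem oldMult_data (τ : OldVertexType) (a : ℕ) : τ.data.oldMult a = τ.mult a := by
  have h : ∃ τ' : OldVertexType, τ.data = τ'.data := ⟨τ, rfl⟩
  have hτ : h.choose = τ := by
    have := h.choose_spec
    generalize h.choose = σ at this
    cases τ <;> cases σ <;> simp_all [OldVertexType.data]
  rw [oldMult, dif_pos h, hτ]

theorem isType_of_old (τ : OldVertexType) :
    τ.data.IsTypeI ∨ τ.data.IsTypeII ∨ τ.data.IsTypeIII := by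
  cases τ <;> simp [OldVertexType.data, IsTypeI, IsTypeII, IsTypeIII]

theorem refinedMult_of_isTypeI {D : VertexData} (h : D.IsTypeI) (a : ℕ) : D.refinedMult a = 1 :=
  if_pos h

theorem refinedMult_of_isTypeII {D : VertexData} (h : D.IsTypeII) (a : ℕ) :
    D.refinedMult a = (yHalf ^ a - yHalf ^ (-(a : ℤ))) / (yHalf - yHalf ^ (-1 : ℤ)) := by
  rw [refinedMult, if_neg, if_pos h]
  intro h'; have := h'.1; have := h.1; omega

theorem refinedMult_of_isTypeIII {D : VertexData} (h : D.IsTypeIII) (a : ℕ) :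
    D.refinedMult a = (yHalf ^ a + yHalf ^ (-(a : ℤ))) / (yHalf + yHalf ^ (-1 : ℤ)) := by
  rw [refinedMult, if_neg, if_neg, if_pos h]
  · intro h'; have := h'.2.1; have := h.2.1; omega
  · intro h'; have := h'.2.1; have := h.2.1; omega

/-- The leading coefficient at `y^{1/2} = i` of the multiplicity of a vertex. -/
noncomputable def leadingCoeff (D : VertexData) (a : ℕ) : ℂ :=
  if D.realMarks = 1 then 1
  else if (D.cplxMarks = 1 ↔ D.evenIn + D.evenOut = 0) then a * Complex.I ^ ((a : ℤ) - 1)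
  else Complex.I ^ ((a : ℤ) - 1)

/-- The factor a occurs for the minus quotient with even edges (3, 4) and the plus quotient without
(5). -/
theorem leadingCoeff_data (τ : OldVertexType) (a : ℕ) :
    τ.data.leadingCoeff a = τ.data.oldMult a := by
  rw [oldMult_data]
  cases τ <;> simp [OldVertexType.data, leadingCoeff, OldVertexType.mult]

/-- At a trivalent vertex a is odd exactly when no adjacent edge is even, so the edge parities
decide which of the four quotients occurs. -/
theorem hasOrder_refinedMult {D : VertexData} {a : ℕ} (hp : D.ParityCompatible a)
    (hD : D.IsTypeI ∨ D.IsTypeII ∨ D.IsTypeIII) :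
    HasOrder (D.refinedMult a) D.order (D.leadingCoeff a) := by
  rcases hD with h | h | h
  · rw [refinedMult_of_isTypeI h]
    obtain ⟨h1, h2, -, -⟩ := h
    simpa [order, leadingCoeff, h1, h2, hasOrder_zero] using specializesTo_one (-1)
  · rw [refinedMult_of_isTypeII h]
    obtain ⟨h1, h2, h3, h4⟩ := h
    by_cases he : D.evenIn + D.evenOut = 0
    · have ha : Odd a := by rcases hp.2 (by omega) with h | h | h <;> [exact h.2; omega; omega]
      simpa only [order, leadingCoeff, h1, h2, he, hasOrder_zero, if_true, zero_ne_one, if_false,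
        iff_true] using specializesTo_sub_of_odd ha
    · have ha : Even a := by rcases hp.2 (by omega) with h | h | h <;> [omega; exact h.2; exact h.2]
      simpa only [order, leadingCoeff, h1, h2, he, hasOrder_one, if_true, zero_ne_one, if_false]
        using specializesTo_sub_of_even ha
  · rw [refinedMult_of_isTypeIII h]
    obtain ⟨h1, h2, h3, h4⟩ := h
    by_cases he : D.evenIn + D.evenOut = 0
    · have ha : Odd a := by rcases hp.2 (by omega) with h | h | h <;> [exact h.2; omega; omega]
      simpa only [order, leadingCoeff, h1, h2, he, hasOrder_zero, if_true, zero_ne_one, if_false]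
        using specializesTo_add_of_odd ha
    · have ha : Even a := by rcases hp.2 (by omega) with h | h | h <;> [omega; exact h.2; exact h.2]
      simpa only [order, leadingCoeff, h1, h2, he, hasOrder_neg_one, if_true, zero_ne_one,
        if_false, iff_false, not_true_eq_false] using specializesTo_add_of_even ha

open Classical in
/-- The order of a vertex differs from its number of incoming minus outgoing even edges by `2` if
the vertex is not of a type (1), ..., (6), and by `0` otherwise. -/
theorem order_eq {D : VertexData} {a : ℕ} (hp : D.ParityCompatible a)
    (hD : D.IsTypeI ∨ D.IsTypeII ∨ D.IsTypeIII) :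
    D.order = 2 * (if ∃ τ : OldVertexType, D = τ.data then 0 else 1) +
      (D.evenIn - D.evenOut) := by
  obtain ⟨rm, cm, oi, oo, ei, eo⟩ := D
  obtain ⟨hp2, hp3⟩ := hp
  have hold : (∃ τ : OldVertexType, VertexData.mk rm cm oi oo ei eo = τ.data) ↔
      (rm = 1 ∧ cm = 0 ∧ oi = 0 ∧ oo = 2 ∧ ei = 0 ∧ eo = 0) ∨
      (rm = 0 ∧ cm = 0 ∧ oi = 2 ∧ oo = 1 ∧ ei = 0 ∧ eo = 0) ∨
      (rm = 0 ∧ cm = 0 ∧ oi = 1 ∧ oo = 1 ∧ ei = 1 ∧ eo = 0) ∨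
      (rm = 0 ∧ cm = 0 ∧ oi = 0 ∧ oo = 0 ∧ ei = 2 ∧ eo = 1) ∨
      (rm = 0 ∧ cm = 1 ∧ oi = 0 ∧ oo = 3 ∧ ei = 0 ∧ eo = 0) ∨
      (rm = 0 ∧ cm = 1 ∧ oi = 0 ∧ oo = 2 ∧ ei = 0 ∧ eo = 1) := by
    constructor
    · rintro ⟨τ, hτ⟩
      cases τ <;> simp_all [OldVertexType.data]
    · rintro (h | h | h | h | h | h)
      exacts [⟨.one, by simp [OldVertexType.data, h]⟩, ⟨.two, by simp [OldVertexType.data, h]⟩,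
        ⟨.three, by simp [OldVertexType.data, h]⟩, ⟨.four, by simp [OldVertexType.data, h]⟩,
        ⟨.five, by simp [OldVertexType.data, h]⟩, ⟨.six, by simp [OldVertexType.data, h]⟩]
  rw [if_congr hold rfl rfl]
  clear hold
  simp only at hp2 hp3
  rcases hD with h | h | h
  · obtain ⟨rfl, rfl, h3, h4⟩ : rm = 1 ∧ cm = 0 ∧ oi + ei = 0 ∧ oo + eo = 2 := h
    obtain ⟨rfl, rfl⟩ : oi = 0 ∧ ei = 0 := by omega
    -- Two even edges give the non-old case: order 0 = 2 + (0 - 2).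
    obtain ⟨rfl, rfl⟩ | ⟨rfl, rfl⟩ : eo = 0 ∧ oo = 2 ∨ eo = 2 ∧ oo = 0 := by omega
    all_goals simp [order]
  · obtain ⟨rfl, rfl, h3, h4⟩ : rm = 0 ∧ cm = 0 ∧ oi + ei = 2 ∧ oo + eo = 1 := h
    -- Two even edges force the third to be even. The non-old case left is an even outgoing edge
    -- with two odd incoming ones: 1 = 2 + (0 - 1).
    replace hp3 : ei + eo ≠ 2 := by rcases hp3 (by omega) with h | h | h <;> omega
    obtain ⟨rfl, rfl⟩ | ⟨rfl, rfl⟩ | ⟨rfl, rfl⟩ :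
        ei = 0 ∧ oi = 2 ∨ ei = 1 ∧ oi = 1 ∨ ei = 2 ∧ oi = 0 := by omega
    all_goals
      obtain ⟨rfl, rfl⟩ | ⟨rfl, rfl⟩ : eo = 0 ∧ oo = 1 ∨ eo = 1 ∧ oo = 0 := by omega
      all_goals simp [order] at hp3 ⊢
  · obtain ⟨rfl, rfl, h3, h4⟩ : rm = 0 ∧ cm = 1 ∧ oi + ei = 0 ∧ oo + eo = 3 := h
    replace hp3 : ei + eo ≠ 2 := by rcases hp3 (by omega) with h | h | h <;> omega
    obtain ⟨rfl, rfl⟩ : oi = 0 ∧ ei = 0 := by omega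
    -- Only three even edges are non-old here: -1 = 2 + (0 - 3).
    obtain ⟨rfl, rfl⟩ | ⟨rfl, rfl⟩ | ⟨rfl, rfl⟩ :
        eo = 0 ∧ oo = 3 ∨ eo = 1 ∧ oo = 2 ∨ eo = 3 ∧ oo = 0 := by omega
    all_goals simp [order]

end VertexData

/-! ### Edge counts and balancing modulo 2 at a vertex of a curve. -/

namespace OrientedMarkedCurve

variable {V : Type*} [Finite V] {r s n : ℕ} {Δ : Fin n → ℤ × ℤ}

open Classical in
theorem evenIn_sub_evenOut (C : OrientedMarkedCurve V r s Δ) (v : V) :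
    ((C.vertexData v).evenIn : ℤ) - (C.vertexData v).evenOut =
      ∑ e : C.Flag v, if C.IsEvenEdge e then if C.IsOut e then -1 else 1 else 0 := by
  simp only [vertexData, Nat.card_eq_fintype_card, Fintype.card_subtype, Finset.card_filter]
  push_cast
  rw [← Finset.sum_sub_distrib]
  refine Finset.sum_congr rfl fun e _ => ?_
  by_cases h1 : C.IsEvenEdge e <;> by_cases h2 : C.IsOut e <;> simp [h1, h2]

open Classical in
theorem evenIn_add_evenOut (C : OrientedMarkedCurve V r s Δ) (v : V) :
    (C.vertexData v).evenIn + (C.vertexData v).evenOut =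
      ∑ e : C.Flag v, if C.IsEvenEdge e then 1 else 0 := by
  simp only [vertexData, Nat.card_eq_fintype_card, Fintype.card_subtype, Finset.card_filter]
  rw [← Finset.sum_add_distrib]
  refine Finset.sum_congr rfl fun e _ => ?_
  by_cases h1 : C.IsEvenEdge e <;> by_cases h2 : C.IsOut e <;> simp [h1, h2]

theorem valence_eq_card_flag (C : OrientedMarkedCurve V r s Δ) (v : V) :
    (C.vertexData v).oddIn + (C.vertexData v).oddOut + (C.vertexData v).evenIn +
      (C.vertexData v).evenOut = Fintype.card (C.Flag v) := by
  classical
  simp only [vertexData, Nat.card_eq_fintype_card, Fintype.card_subtype, Finset.card_filter]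
  rw [← Finset.sum_add_distrib, ← Finset.sum_add_distrib, ← Finset.sum_add_distrib,
    ← Finset.card_univ, Finset.card_eq_sum_ones]
  refine Finset.sum_congr rfl fun e _ => ?_
  by_cases h1 : C.IsEvenEdge e <;> by_cases h2 : C.IsOut e <;> simp [h1, h2]

theorem isEvenEdge_iff (C : OrientedMarkedCurve V r s Δ) {v : V} (e : C.Flag v) :
    C.IsEvenEdge e ↔ Even (C.vec e).1 ∧ Even (C.vec e).2 :=
  even_vecWeight_iff _

/-- An edge is even iff its vector vanishes in 𝔽₂². Three nonzero vectors of 𝔽₂² with sum 0 are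
distinct, so any two have determinant 1; if one vector vanishes, the other two agree and the
determinant is 0. -/
theorem parityCompatible (C : OrientedMarkedCurve V r s Δ) (v : V) :
    (C.vertexData v).ParityCompatible (C.mikhalkinMult v) := by
  classical
  have hb : ∑ x : C.Flag v, C.vec x = 0 := C.balanced v
  rw [VertexData.ParityCompatible, valence_eq_card_flag, evenIn_add_evenOut]
  constructor
  · intro h
    obtain ⟨x, z, hxz, hu⟩ := Finset.card_eq_two.1 (Finset.card_univ.trans h)
    rw [hu, Finset.sum_pair hxz] at hb ⊢
    have hz : C.vec z = -C.vec x := by rw [eq_neg_iff_add_eq_zero, add_comm, hb]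
    simp only [isEvenEdge_iff, hz, Prod.fst_neg, Prod.snd_neg, even_neg]
    split_ifs <;> simp
  · intro h
    obtain ⟨x, z, t, hxz, hxt, hzt, hu⟩ := Finset.card_eq_three.1 (Finset.card_univ.trans h)
    rw [C.mikhalkinMult_eq v (Nat.card_eq_fintype_card.trans h) hxz, Int.natAbs_odd,
      Int.natAbs_even, det2]
    rw [hu, Finset.sum_insert (by simp [hxz, hxt]), Finset.sum_pair hzt] at hb ⊢
    have ht : C.vec t = -(C.vec x + C.vec z) := by
      rw [eq_neg_iff_add_eq_zero, ← hb]; abel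
    simp only [isEvenEdge_iff, ht, Prod.fst_neg, Prod.snd_neg, Prod.fst_add, Prod.snd_add,
      even_neg, ← Int.not_even_iff_odd, Int.even_sub, Int.even_mul, Int.even_add]
    by_cases h1 : Even (C.vec x).1 <;> by_cases h2 : Even (C.vec x).2 <;>
      by_cases h3 : Even (C.vec z).1 <;> by_cases h4 : Even (C.vec z).2 <;> simp [h1, h2, h3, h4]

end OrientedMarkedCurve

/-! ### Cancellation along bounded edges. -/

namespace OrientedMarkedCurve

variable {V : Type*} [Fintype V] {r s n : ℕ} {Δ : Fin n → ℤ × ℤ}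

open Classical in
/-- Every bounded even edge is incoming at one of its vertices and outgoing at the other. -/
theorem sum_evenIn_sub_evenOut (C : OrientedMarkedCurve V r s Δ) :
    ∑ v : V, (((C.vertexData v).evenIn : ℤ) - (C.vertexData v).evenOut) =
      ∑ i : Fin n, if Even (vecWeight (Δ i)) then if i ∈ C.F then 1 else -1 else 0 := by
  simp only [evenIn_sub_evenOut]
  have hsplit : ∀ v : V,
      (∑ e : C.Flag v, if C.IsEvenEdge e then if C.IsOut e then (-1 : ℤ) else 1 else 0) =
      (∑ d : {d : C.bdd.Dart // d.fst = v},
        if Even (vecWeight (C.dir d.1)) then if C.orient d.1 then (-1 : ℤ) else 1 else 0) +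
      ∑ i : {i : Fin n // C.endAt i = v},
        if Even (vecWeight (Δ i.1)) then if i.1 ∈ C.F then (1 : ℤ) else -1 else 0 := by
    intro v
    trans ∑ e : {d : C.bdd.Dart // d.fst = v} ⊕ {i : Fin n // C.endAt i = v},
        Sum.elim (fun d => if Even (vecWeight (C.dir d.1)) then
          if C.orient d.1 then (-1 : ℤ) else 1 else 0)
        (fun i => if Even (vecWeight (Δ i.1)) then if i.1 ∈ C.F then (1 : ℤ) else -1 else 0) e
    · let φ : C.Flag v ≃ {d : C.bdd.Dart // d.fst = v} ⊕ {i : Fin n // C.endAt i = v} :=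
        Equiv.refl _
      refine Fintype.sum_equiv φ _ _ ?_
      rintro (d | i)
      · have hφ : φ (Sum.inl d) = Sum.inl d := rfl
        rw [hφ]
        by_cases h : C.orient d.1 <;> simp [IsEvenEdge, IsOut, vec, h]
      · have hφ : φ (Sum.inr i) = Sum.inr i := rfl
        rw [hφ]
        by_cases h : i.1 ∈ C.F <;> simp [IsEvenEdge, IsOut, vec, h]
    · exact Fintype.sum_sum_type _
  have hdarts : (∑ d : C.bdd.Dart,
      if Even (vecWeight (C.dir d)) then if C.orient d then (-1 : ℤ) else 1 else 0) = 0 := by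
    -- Reversing a dart keeps the weight and flips the orientation, so the contributions pair off to
    -- 0.
    refine Finset.sum_involution (fun d _ => d.symm) (fun d _ => ?_) (fun d _ _ => d.symm_ne)
      (fun d _ => Finset.mem_univ _) (fun d _ => d.symm_symm)
    have hw : vecWeight (C.dir d.symm) = vecWeight (C.dir d) := by simp [C.dir_symm, vecWeight]
    have ho := C.orient_symm d
    by_cases h : C.orient d <;> simp [hw, ho, h] <;> split_ifs <;> rfl
  rw [Finset.sum_congr rfl fun v _ => hsplit v, Finset.sum_add_distrib,
    Fintype.sum_fiberwise (fun d : C.bdd.Dart => d.fst)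
      (fun d => if Even (vecWeight (C.dir d)) then if C.orient d then (-1 : ℤ) else 1 else 0),
    Fintype.sum_fiberwise C.endAt
      (fun i => if Even (vecWeight (Δ i)) then if i ∈ C.F then (1 : ℤ) else -1 else 0),
    hdarts, zero_add]

end OrientedMarkedCurve

/-! ### Assembling the orders of all factors. -/

theorem corollary3p9 {V : Type*} [Fintype V] {r s n : ℕ} {Δ : Fin n → ℤ × ℤ}
    (C : OrientedMarkedCurve V r s Δ) :
    (C.IsOldBroccoli →
      C.IsRefinedBroccoli ∧ SpecializesTo C.refinedMult (-1) C.oldMult) ∧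
    (C.IsRefinedBroccoli → ¬ C.IsOldBroccoli → SpecializesTo C.refinedMult (-1) 0) := by
  classical
  have key : C.IsRefinedBroccoli → HasOrder C.refinedMult
      (2 * ((Finset.univ.filter fun v => ¬ ∃ τ : OldVertexType, C.vertexData v = τ.data).card : ℕ))
      ((∏ k : Fin n, Complex.I ^ ((vecWeight (Δ k) : ℤ) - 1)) *
        ∏ v : V, (C.vertexData v).leadingCoeff (C.mikhalkinMult v)) := by
    intro h
    have hends := HasOrder.prod Finset.univ fun (i : Fin n) _ =>
      (show HasOrder (if i ∈ C.F then fixedEndMult (vecWeight (Δ i))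
          else freeEndMult (vecWeight (Δ i)))
        (-(if Even (vecWeight (Δ i)) then if i ∈ C.F then 1 else -1 else 0))
        (Complex.I ^ ((vecWeight (Δ i) : ℤ) - 1)) by
        have h1 := hasOrder_fixedEndMult (vecWeight (Δ i))
        have h2 := hasOrder_freeEndMult (vecWeight_ne_zero (C.degree_ne_zero i))
        split_ifs with hF he he
        · simpa only [he, if_true] using h1
        · simpa only [he, if_false, neg_zero] using h1
        · simpa only [he, if_true, neg_neg] using h2
        · simpa only [he, if_false, neg_zero] using h2)
    have hverts := HasOrder.prod Finset.univ fun (v : V) _ =>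
      VertexData.hasOrder_refinedMult (C.parityCompatible v) (h.2 v)
    have hmul := hends.mul hverts
    convert hmul using 1
    · rfl
    -- The end exponents are the negatives of the terms in `sum_evenIn_sub_evenOut`, so only the 2
    -- per non-old vertex survives.
    rw [Finset.sum_congr rfl fun v _ => VertexData.order_eq (C.parityCompatible v) (h.2 v),
      Finset.sum_add_distrib, C.sum_evenIn_sub_evenOut, Finset.sum_neg_distrib,
      ← Finset.mul_sum, Finset.card_filter]
    push_cast
    simp only [ite_not]
    ring
  constructor
  · intro h
    have hr : C.IsRefinedBroccoli := ⟨h.1, fun v => by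
      obtain ⟨τ, hτ⟩ := h.2 v
      rw [hτ]
      exact VertexData.isType_of_old τ⟩
    refine ⟨hr, ?_⟩
    have hk := key hr
    -- With total exponent 0 the powers of θ and of 2i disappear, leaving the product of leading
    -- coefficients.
    rw [Finset.filter_false_of_mem fun v _ => not_not.2 (h.2 v), Finset.card_empty,
      Nat.cast_zero, mul_zero, hasOrder_zero] at hk
    convert hk using 1
    rw [OrientedMarkedCurve.oldMult]
    congr 1
    refine Finset.prod_congr rfl fun v _ => ?_
    obtain ⟨τ, hτ⟩ := h.2 v
    rw [hτ, VertexData.leadingCoeff_data]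
  · intro h hn
    refine (key h).specializesTo_zero (Finset.card_ne_zero.2 ?_)
    have : ¬ ∀ v, ∃ τ : OldVertexType, C.vertexData v = τ.data := fun h' => hn ⟨h.1, h'⟩
    rw [not_forall] at this
    obtain ⟨v, hv⟩ := this
    exact ⟨v, Finset.mem_filter.2 ⟨Finset.mem_univ v, hv⟩⟩
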